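/- **Model.** A *network* $G=(V,E,\ell)$ is an undirected graph $(V,E)$ (self-loops allowed) with a label $\ell(u,v)\in\mathbb N$ for each ordered pair of adjacent vertices. Its automorphisms are the permutations of $V$ preserving adjacencies and labels. Put $\mathbb N_n=\{0,\dots,n-1\}$. An *arrangement* of $k$ robots on $G$ is a map $a\colon\mathbb N_k\to V$; arrangements $a_1,a_2$ are *equivalent under* an automorphism $\alpha$ and a permutation $\pi$ of $\mathbb N_k$ if $\alpha\circ a_1=a_2\circ\pi$. The set $\mathcal C(G,k)$ of *configurations* is the set of equivalence classes of arrangements. Two vertices $v,w$ are equivalent in $a$ if $\alpha(v)=w$ for some $\alpha,\pi$ under which $a$ is equivalent to itself. A *class of indistinguishable vertices* $U$ of a configuration $C$ selects, for each $a\in C$, an equivalence class $U(a)$ of vertices of $a$, such that $\alpha(U(a_1))=U(a_2)$ whenever $a_1,a_2\in C$ are equivalent under $\alpha$ and some $\pi$. An *algorithm* $A$ maps each configuration $C$ and each class $U$ of indistinguishable vertices of $C$ to such a class $A(C,U)$ of $C$, where for all $a\in C$ and $u\in U(a)$ some $u'\in A(C,U)(a)$ is equal or adjacent to $u$. A (fully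 synchronous) *execution* of $A$ is a sequence $(C_i)_{i\ge0}$ of configurations such that for every $i$ and every $a\in C_i$ there is $a'\in C_{i+1}$ such that, for every robot $r$, $a'(r)$ is equal or adjacent to $a(r)$ and $a'(r)\in U'(a)$ with $U'=A(C_i,U)$, where $U$ is the class with $a(r)\in U(a)$. An algorithm $A$ for $k$ robots on $G$ *simulates* an algorithm $A'$ for $k'$ robots on $G'$ if there is a surjective partial function $\varphi\colon\mathcal C(G,k)\to\mathcal C(G',k')$ such that for each execution $(C_i)$ of $A$ there is an execution $(C'_i)$ of $A'$ such that either $\varphi(C_0)$ is undefined, or there is a weakly increasing surjection $\sigma\colon\mathbb N\to\mathbb N$ such that, for all $i$, $\varphi(C_i)$ is defined and equal to $C'_{\sigma(i)}$. For $f\colon\mathbb N_n\to\mathbb N_n$, let $\Gamma_f$ be the network on $\mathbb N_n$ with edges $\{x,f(x)\}$ and labels $\ell(u,v)=v$, and let $A_f$ be the algorithm for one robot on $\Gamma_f$ that always moves it from $x$ to $f(x)$. Then $k$ robots on $G$ *compute* $f$ if some algorithm for $k$ robots on $G$ simulates $A_f$. The *oriented path* with $N$ vertices is the path $0,1,\dots,N-1$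 with $\ell(i,i+1)=1$ and $\ell(i+1,i)=0$. **Theorem.** For every $n\ge1$ there is exactly one $m$ with $(m-1)!<2n\le m!$ (here $m\geq 2$), and for this $m$ every function $f\colon\mathbb N_n\to\mathbb N_n$ is computed by $m(m-1)$ robots on the oriented path with $2m$ vertices. In particular, for every $m\ge2$, with $|V|=2m$, the $m(m-1)$ robots on the oriented path with $|V|$ vertices compute all functions on a set of size $\tfrac12\,(|V|/2)!$. -/

import Mathlib

namespace MobileRobots

/-- A labeled graph (network) on the vertex set `V`. The base graph is undirected and may have
self-loops; `label u v` is meaningful only when `u` and `v` are adjacent. -/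
structure Network (V : Type*) where
  Adj : V → V → Prop
  symm : ∀ u v, Adj u v → Adj v u
  label : V → V → ℕ

variable {V V' : Type*}

/-- A permutation of the vertices preserving adjacencies and labels. -/
structure IsAutomorphism (G : Network V) (α : Equiv.Perm V) : Prop where
  adj_iff : ∀ u v, G.Adj (α u) (α v) ↔ G.Adj u v
  label_eq : ∀ u v, G.Adj u v → G.label (α u) (α v) = G.label u v

theorem IsAutomorphism.refl (G : Network V) : IsAutomorphism G (Equiv.refl V) :=
  ⟨fun _ _ => Iff.rfl, fun _ _ _ => rfl⟩

theorem IsAutomorphism.symm {G : Network V} {α : Equiv.Perm V} (h : IsAutomorphism G α) :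
    IsAutomorphism G α.symm := by
  refine ⟨fun u v => ?_, fun u v huv => ?_⟩
  · simpa using (h.adj_iff (α.symm u) (α.symm v)).symm
  · have h1 : G.Adj (α.symm u) (α.symm v) := (h.adj_iff _ _).1 (by simpa using huv)
    simpa using (h.label_eq _ _ h1).symm

theorem IsAutomorphism.trans {G : Network V} {α β : Equiv.Perm V} (h : IsAutomorphism G α)
    (h' : IsAutomorphism G β) : IsAutomorphism G (α.trans β) :=
  ⟨fun u v => (h'.adj_iff _ _).trans (h.adj_iff u v),
    fun u v huv => (h'.label_eq _ _ ((h.adj_iff u v).2 huv)).trans (h.label_eq u v huv)⟩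

/-- An arrangement of `k` (distinguishable) robots on the vertex set `V`. -/
abbrev Arrangement (V : Type*) (k : ℕ) := Fin k → V

/-- The arrangements `a₁` and `a₂` are equivalent under `α` and `π`. -/
def EquivUnder (G : Network V) {k : ℕ} (a₁ a₂ : Arrangement V k) (α : Equiv.Perm V)
    (π : Equiv.Perm (Fin k)) : Prop :=
  IsAutomorphism G α ∧ ∀ r, α (a₁ r) = a₂ (π r)

/-- Equivalence of arrangements. -/
def arrangementSetoid (G : Network V) (k : ℕ) : Setoid (Arrangement V k) where
  r a₁ a₂ := ∃ α π, EquivUnder G a₁ a₂ α π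
  iseqv :=
    { refl := fun _ => ⟨Equiv.refl V, Equiv.refl _, IsAutomorphism.refl G, fun _ => rfl⟩
      symm := by
        rintro a₁ a₂ ⟨α, π, hα, h⟩
        refine ⟨α.symm, π.symm, hα.symm, fun r => ?_⟩
        rw [Equiv.symm_apply_eq, h, Equiv.apply_symm_apply]
      trans := by
        rintro a₁ a₂ a₃ ⟨α, π, hα, h⟩ ⟨β, ρ, hβ, h'⟩
        exact ⟨α.trans β, π.trans ρ, hα.trans hβ, fun r => by simp [h, h']⟩ }

/-- The configuration space of `k` robots on `G`. -/
def Config (G : Network V) (k : ℕ) := Quotient (arrangementSetoid G k)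

/-- The configuration of an arrangement. -/
def Config.mk (G : Network V) {k : ℕ} (a : Arrangement V k) : Config G k :=
  Quotient.mk (arrangementSetoid G k) a

/-- The arrangements that belong to the configuration `C`. -/
abbrev Config.Member {G : Network V} {k : ℕ} (C : Config G k) :=
  {a : Arrangement V k // Config.mk G a = C}

/-- `v` and `w` are equivalent vertices in the arrangement `a`. -/
def EquivVertices (G : Network V) {k : ℕ} (a : Arrangement V k) (v w : V) : Prop :=
  ∃ α π, EquivUnder G a a α π ∧ α v = w

/-- A class of indistinguishable vertices of a configuration: it selects, in every arrangement of
the configuration, an equivalence class of vertices, consistently with all equivalences of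
arrangements. -/
structure VertexClass {G : Network V} {k : ℕ} (C : Config G k) where
  sel : C.Member → Set V
  isClass : ∀ a, ∃ v, sel a = {w | EquivVertices G a.1 v w}
  equivariant : ∀ (a₁ a₂ : C.Member) (α : Equiv.Perm V) (π : Equiv.Perm (Fin k)),
    EquivUnder G a₁.1 a₂.1 α π → α '' sel a₁ = sel a₂

/-- An algorithm for `k` robots on `G`: from the configuration and the class of the executing
robot's location it computes the class of the destination, which must be reachable by a null
movement or a movement to an adjacent vertex. -/
structure Algorithm (G : Network V) (k : ℕ) where
  dest : (C : Config G k) → VertexClass C → VertexClass C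
  reachable : ∀ (C : Config G k) (U : VertexClass C) (a : C.Member), ∀ u ∈ U.sel a,
    ∃ u' ∈ (dest C U).sel a, u = u' ∨ G.Adj u u'

/-- Executions, regarded as arbitrary sequences of configurations. -/
abbrev Execution (G : Network V) (k : ℕ) := ℕ → Config G k

/-- A scheduler relates algorithms to their possible executions. -/
abbrev Scheduler (G : Network V) (k : ℕ) := Algorithm G k → Execution G k → Prop

/-- A system of oblivious mobile robots (of interest when `robots` is positive). -/
structure RobotSystem (V : Type*) where
  net : Network V
  robots : ℕ
  sched : Scheduler net robots

/-- `C'` yields from `C` under `A`: every robot moves, by at most one hop, to a vertex of the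
destination class that it computes. -/
def Yields {G : Network V} {k : ℕ} (A : Algorithm G k) (C C' : Config G k) : Prop :=
  ∀ a : C.Member, ∃ a' : C'.Member, ∀ r : Fin k,
    (a.1 r = a'.1 r ∨ G.Adj (a.1 r) (a'.1 r)) ∧
      ∀ U : VertexClass C, a.1 r ∈ U.sel a → a'.1 r ∈ (A.dest C U).sel a

/-- The fully synchronous scheduler. -/
def fullySynchronous (G : Network V) (k : ℕ) : Scheduler G k :=
  fun A E => ∀ i, Yields A (E i) (E (i + 1))

/-- The system of `k` robots on `G` under the fully synchronous scheduler. -/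
def FS (G : Network V) (k : ℕ) : RobotSystem V := ⟨G, k, fullySynchronous G k⟩

/-- Compliance of executions under the partial function `φ` (`none` means undefined). -/
def Compliant {G : Network V} {k : ℕ} {G' : Network V'} {k' : ℕ}
    (φ : Config G k → Option (Config G' k')) (E : Execution G k) (E' : Execution G' k') : Prop :=
  φ (E 0) = none ∨
    ∃ σ : ℕ → ℕ, Monotone σ ∧ Function.Surjective σ ∧ ∀ i, φ (E i) = some (E' (σ i))

/-- The algorithm `A` under `Ψ` simulates the algorithm `A'` under `Ψ'`. -/
def Simulates (Ψ : RobotSystem V) (A : Algorithm Ψ.net Ψ.robots)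
    (Ψ' : RobotSystem V') (A' : Algorithm Ψ'.net Ψ'.robots) : Prop :=
  ∃ φ : Config Ψ.net Ψ.robots → Option (Config Ψ'.net Ψ'.robots),
    (∀ D, ∃ C, φ C = some D) ∧
      ∀ E, Ψ.sched A E → ∃ E', Ψ'.sched A' E' ∧ Compliant φ E E'

/-- The network induced by a function on `{0, …, n - 1}`: its edges are the pairs `{x, f x}`
(self-loops included) and the label of `(u, v)` is `v`. -/
def inducedNetwork {n : ℕ} (f : Fin n → Fin n) : Network (Fin n) where
  Adj u v := f u = v ∨ f v = u
  symm _ _ h := h.symm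
  label _ v := v

theorem inducedNetwork_automorphism {n : ℕ} (f : Fin n → Fin n) {α : Equiv.Perm (Fin n)}
    (h : IsAutomorphism (inducedNetwork f) α) (v : Fin n) : α v = v :=
  Fin.ext (h.label_eq (f v) v (Or.inr rfl))

theorem inducedNetwork_equivVertices {n : ℕ} (f : Fin n → Fin n) {k : ℕ}
    (a : Arrangement (Fin n) k) (v w : Fin n) :
    EquivVertices (inducedNetwork f) a v w ↔ w = v := by
  constructor
  · rintro ⟨α, π, h, hv⟩
    rw [← hv, inducedNetwork_automorphism f h.1]
  · rintro rfl
    exact ⟨Equiv.refl _, Equiv.refl _, ⟨IsAutomorphism.refl _, fun _ => rfl⟩, rfl⟩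

/-- The algorithm associated to `f`: the unique robot of the induced network moves from any vertex
`x` to the vertex `f x`. -/
def associatedAlgorithm {n : ℕ} (f : Fin n → Fin n) : Algorithm (inducedNetwork f) 1 where
  dest C U :=
    { sel := fun a => f '' U.sel a
      isClass := fun a => by
        obtain ⟨v, hv⟩ := U.isClass a
        refine ⟨f v, ?_⟩
        rw [hv]
        ext w
        simp [inducedNetwork_equivVertices, eq_comm]
      equivariant := fun a₁ a₂ α π h => by
        have hα : (α : Fin n → Fin n) = id := funext (inducedNetwork_automorphism f h.1)
        have hU := U.equivariant a₁ a₂ α π h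
        rw [hα, Set.image_id] at hU ⊢
        rw [hU] }
  reachable C U a u hu := ⟨f u, ⟨u, hu, rfl⟩, Or.inr (Or.inl rfl)⟩

/-- The system `Ψ` computes the function `f` on `{0, …, n - 1}`. -/
def Computes (Ψ : RobotSystem V) {n : ℕ} (f : Fin n → Fin n) : Prop :=
  ∃ A : Algorithm Ψ.net Ψ.robots, Simulates Ψ A (FS (inducedNetwork f) 1) (associatedAlgorithm f)

/-- The system `Ψ` is universal for `{0, …, n - 1}`. -/
def UniversalFor (Ψ : RobotSystem V) (n : ℕ) : Prop :=
  ∀ f : Fin n → Fin n, Computes Ψ f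

/-- The oriented path on `n` vertices: the port towards the next vertex is labeled `1`, the port
towards the previous vertex is labeled `0`. -/
def orientedPath (n : ℕ) : Network (Fin n) where
  Adj := (SimpleGraph.pathGraph n).Adj
  symm _ _ h := h.symm
  label u v := if u < v then 1 else 0

/-- The oriented path with `n` vertices and `k` robots, under the fully synchronous scheduler. -/
def OP (n k : ℕ) : RobotSystem (Fin n) := FS (orientedPath n) k

end MobileRobots

/-! An oriented path has no nontrivial automorphism, so an algorithm may prescribe the move of each
vertex freely, and its executions are deterministic. Split the path into halves of `m` vertices and
put piles of 0, 1, …, m - 1 robots on each half. The order of the piles makes each half a register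
holding a permutation of `Fin m`; exchanging two neighbouring piles is one synchronous step.

A map `c` gives each permutation a value in `Fin n`. It is invariant under left multiplication by a
fixed adjacent swap `s`, so a register can change sign while keeping its value; this halving of the
capacity explains `2 * n ≤ m.factorial`. Equal signs mean that the first register holds the current
value `x`, unequal signs that the second does. The holder idles with `s` while the other register is
driven by adjacent swaps to `f x` (equal signs) or to a copy of `x` (unequal signs). Both signs
flip, so the phase persists. At the target one register rests while the other applies `s`, which
toggles the phase. Thus the value changes only by applications of `f`, and these recur forever. -/

namespace MobileRobots

open Equiv

/-! ### Networks without nontrivial automorphisms -/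

section Rigid

variable {V : Type*} {G : Network V} {k : ℕ}

/-- A network is rigid if its only automorphism is the identity. -/
def Network.Rigid (G : Network V) : Prop :=
  ∀ α : Perm V, IsAutomorphism G α → ∀ v, α v = v

theorem Network.Rigid.equivVertices_iff (hG : G.Rigid) (a : Arrangement V k) (v w : V) :
    EquivVertices G a v w ↔ w = v := by
  constructor
  · rintro ⟨α, π, h, rfl⟩
    exact hG α h.1 v
  · rintro rfl
    exact ⟨Equiv.refl _, Equiv.refl _, ⟨IsAutomorphism.refl _, fun _ => rfl⟩, rfl⟩

theorem Network.Rigid.mk_eq_mk (hG : G.Rigid) {a b : Arrangement V k}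
    (h : Config.mk G a = Config.mk G b) : ∃ π : Perm (Fin k), ∀ r, a r = b (π r) := by
  obtain ⟨α, π, hα, h⟩ := Quotient.exact h
  exact ⟨π, fun r => by rw [← h r, hG α hα]⟩

/-- In a rigid network, a vertex forms a class of indistinguishable vertices. -/
def Network.Rigid.vertexClass (hG : G.Rigid) (C : Config G k) (v : V) : VertexClass C where
  sel _ := {v}
  isClass a := ⟨v, by ext w; simp [hG.equivVertices_iff]⟩
  equivariant _ _ α _ h := by simp [hG α h.1]

/-- The algorithm that moves the robots located at `v` in the configuration `C` to `g C v`. -/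
def Network.Rigid.algorithm (hG : G.Rigid) (g : Config G k → V → V)
    (hg : ∀ C v, v = g C v ∨ G.Adj v (g C v)) : Algorithm G k where
  dest C U :=
    { sel := fun a => g C '' U.sel a
      isClass := fun a => by
        obtain ⟨v, hv⟩ := U.isClass a
        refine ⟨g C v, ?_⟩
        rw [hv]
        ext w
        simp [hG.equivVertices_iff, eq_comm]
      equivariant := fun a₁ a₂ α π h => by
        have hα : (α : V → V) = id := funext (hG α h.1)
        have hU := U.equivariant a₁ a₂ α π h
        rw [hα, Set.image_id] at hU ⊢
        rw [hU] }
  reachable C _ _ u hu := ⟨g C u, ⟨u, hu, rfl⟩, hg C u⟩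

theorem Network.Rigid.eq_of_yields (hG : G.Rigid) {g : Config G k → V → V}
    {hg : ∀ C v, v = g C v ∨ G.Adj v (g C v)} {a : Arrangement V k} {C' : Config G k}
    (h : Yields (hG.algorithm g hg) (Config.mk G a) C') :
    C' = Config.mk G fun r => g (Config.mk G a) (a r) := by
  obtain ⟨⟨a', rfl⟩, ha'⟩ := h ⟨a, rfl⟩
  congr 1
  funext r
  have := (ha' r).2 (hG.vertexClass _ (a r)) rfl
  simpa [Network.Rigid.algorithm, Network.Rigid.vertexClass] using this

end Rigid

/-! ### Simulation of an iterated function -/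

theorem inducedNetwork_rigid {n : ℕ} (f : Fin n → Fin n) : (inducedNetwork f).Rigid :=
  fun _ => inducedNetwork_automorphism f

theorem associatedAlgorithm_yields {n : ℕ} (f : Fin n → Fin n) (x : Fin n) :
    Yields (associatedAlgorithm f) (Config.mk (inducedNetwork f) fun _ => x)
      (Config.mk (inducedNetwork f) fun _ => f x) := by
  rintro ⟨a, ha⟩
  refine ⟨⟨fun _ => f x, rfl⟩, fun r => ?_⟩
  obtain ⟨π, hπ⟩ := (inducedNetwork_rigid f).mk_eq_mk ha
  exact ⟨Or.inr (Or.inl (congrArg f (hπ r))), fun U hU => ⟨a r, hU, congrArg f (hπ r)⟩⟩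

theorem eq_iterate_count {S X : Type*} {f : X → X} {step : S → S} {val : S → X} {adv : S → Prop}
    [DecidablePred adv] (hval : ∀ s, val (step s) = if adv s then f (val s) else val s) (s : S)
    (i : ℕ) : val (step^[i] s) = f^[Nat.count (fun j => adv (step^[j] s)) i] (val s) := by
  induction i with
  | zero => simp
  | succ i ih =>
    rw [Function.iterate_succ_apply', hval, ih, Nat.count_succ]
    split_ifs
    · rw [Function.iterate_succ_apply']
    · rfl

theorem count_surjective {p : ℕ → Prop} [DecidablePred p] (hp : ∀ i, ∃ j, p (i + j)) :
    Function.Surjective (Nat.count p) := by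
  have hinf := Nat.frequently_atTop_iff_infinite.1 (Filter.frequently_atTop.2 fun i => by
    obtain ⟨j, hj⟩ := hp i
    exact ⟨i + j, Nat.le_add_right i j, hj⟩)
  exact fun i => ⟨Nat.nth p i, Nat.count_nth_of_infinite hinf i⟩

/-- A rigid network computes `f` if some of its configurations are encoded by a deterministic
system that steps by local moves and repeatedly applies `f` to a value of its state. -/
theorem Network.Rigid.computes {V : Type*} {G : Network V} {k : ℕ} (hG : G.Rigid) {n : ℕ}
    {f : Fin n → Fin n} (x : Fin n) {S : Type*} (arr : S → Arrangement V k)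
    (harr : Function.Injective fun s => Config.mk G (arr s)) (move : S → V → V)
    (hmove : ∀ s v, v = move s v ∨ G.Adj v (move s v)) (step : S → S)
    (hstep : ∀ s r, arr (step s) r = move s (arr s r)) (val : S → Fin n)
    (hsurj : Function.Surjective val) (adv : S → Prop) [DecidablePred adv]
    (hval : ∀ s, val (step s) = if adv s then f (val s) else val s)
    (hadv : ∀ s, ∃ i, adv (step^[i] s)) : Computes (FS G k) f := by
  -- Configurations that encode no state decode to `none`: there the robots stay put and `φ` is
  -- undefined.
  obtain ⟨dec, hinv⟩ : ∃ dec : Config G k → Option S,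
      ∀ s C, dec C = some s ↔ Config.mk G (arr s) = C := ⟨_, harr.isPartialInv⟩
  have hdec : ∀ s, dec (Config.mk G (arr s)) = some s := fun s => (hinv s _).2 rfl
  let g : Config G k → V → V := fun C v => (dec C).elim v fun s => move s v
  have hg : ∀ C v, v = g C v ∨ G.Adj v (g C v) := by
    intro C v
    cases h : dec C with
    | none => exact Or.inl (by simp [g, h])
    | some s => simpa [g, h] using hmove s v
  have hexec : ∀ x, fullySynchronous (inducedNetwork f) 1 (associatedAlgorithm f)
      fun i => Config.mk (inducedNetwork f) fun _ => f^[i] x := fun x i => by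
    simpa only [Function.iterate_succ_apply'] using associatedAlgorithm_yields f (f^[i] x)
  let φ : Config G k → Option (Config (inducedNetwork f) 1) :=
    fun C => (dec C).map fun s => Config.mk (inducedNetwork f) fun _ => val s
  have hφ : ∀ s, φ (Config.mk G (arr s)) = some (Config.mk (inducedNetwork f) fun _ => val s) :=
    fun s => by simp only [φ, hdec, Option.map_some]
  refine ⟨hG.algorithm g hg, φ, ?_, ?_⟩
  · intro D
    obtain ⟨b, rfl⟩ := Quotient.exists_rep D
    obtain ⟨s, hs⟩ := hsurj (b (0 : Fin 1))
    refine ⟨Config.mk G (arr s), ?_⟩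
    have hb : b = fun _ => val s :=
      funext fun (r : Fin 1) => by rw [hs, Subsingleton.elim r (0 : Fin 1)]
    exact hb ▸ hφ s
  · intro E hE
    cases h : dec (E 0) with
    -- Compliance is vacuous here; `x` only supplies some execution.
    | none => exact ⟨_, hexec x, Or.inl (congrArg (Option.map _) h)⟩
    | some s =>
      have hEi : ∀ i, E i = Config.mk G (arr (step^[i] s)) := by
        intro i
        induction i with
        | zero => exact ((hinv _ _).1 h).symm
        | succ i ih =>
          have hy := hE i
          rw [ih] at hy
          rw [hG.eq_of_yields hy, Function.iterate_succ_apply']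
          congr 1
          funext r
          simp only [g, hdec, hstep, Option.elim_some]
      -- The time change `σ` counts the earlier steps at which `f` was applied.
      refine ⟨_, hexec (val s), Or.inr ⟨Nat.count fun j => adv (step^[j] s),
        Nat.count_monotone _, count_surjective fun i => ?_, fun i => ?_⟩⟩
      · obtain ⟨j, hj⟩ := hadv (step^[i] s)
        exact ⟨j, by rwa [Nat.add_comm, Function.iterate_add_apply]⟩
      · rw [hEi]
        exact (hφ _).trans (by rw [eq_iterate_count hval]; rfl)

/-- Labels force successors to go to successors, so an automorphism is a shift; the last vertex
leaves no room for a positive one. -/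
theorem orientedPath_rigid (N : ℕ) : (orientedPath N).Rigid := by
  intro α hα
  have hsucc : ∀ u v : Fin N, u.val + 1 = v.val → (α u).val + 1 = (α v).val := by
    intro u v huv
    have hadj : (orientedPath N).Adj u v := SimpleGraph.pathGraph_adj.2 (Or.inl huv)
    have h1 := SimpleGraph.pathGraph_adj.1 ((hα.adj_iff u v).2 hadj)
    have h2 := hα.label_eq u v hadj
    have huv' : u < v := by rw [Fin.lt_def]; omega
    simp only [orientedPath, huv', if_true] at h2
    have h3 : α u < α v := by
      by_contra h
      simp [h] at h2
    rw [Fin.lt_def] at h3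
    omega
  have hall : ∀ i (hi : i < N), (α ⟨i, hi⟩).val = (α ⟨0, by omega⟩).val + i := by
    intro i
    induction i with
    | zero => intro hi; rfl
    | succ i ih =>
      intro hi
      rw [← hsucc ⟨i, by omega⟩ ⟨i + 1, hi⟩ rfl, ih (by omega)]
      rfl
  intro v
  have h1 := hall v.1 v.2
  have h2 := hall (N - 1) (by have := v.2; omega)
  have h3 := (α ⟨N - 1, by have := v.2; omega⟩).2
  apply Fin.ext
  have h4 : (α v).val = (α ⟨0, by have := v.2; omega⟩).val + v.val := h1
  omega

/-! ### Permutations as registers -/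

section Registers

variable {m : ℕ}

/-- A transposition of two consecutive positions. -/
def IsAdjSwap (t : Perm (Fin m)) : Prop :=
  ∃ i j : Fin m, i.val + 1 = j.val ∧ t = swap i j

theorem IsAdjSwap.sign {t : Perm (Fin m)} (ht : IsAdjSwap t) : Perm.sign t = -1 := by
  obtain ⟨i, j, hij, rfl⟩ := ht
  exact Perm.sign_swap fun h => by rw [h] at hij; omega

theorem IsAdjSwap.apply {t : Perm (Fin m)} (ht : IsAdjSwap t) (v : Fin m) :
    v = t v ∨ v.val + 1 = (t v).val ∨ (t v).val + 1 = v.val := by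
  obtain ⟨i, j, hij, rfl⟩ := ht
  rcases eq_or_ne v i with rfl | hi
  · simp [hij]
  rcases eq_or_ne v j with rfl | hj
  · simp [hij]
  · exact Or.inl (swap_apply_of_ne_of_ne hi hj).symm

theorem mclosure_isAdjSwap : Submonoid.closure {t : Perm (Fin m) | IsAdjSwap t} = ⊤ := by
  cases m with
  | zero => exact Subsingleton.elim _ _
  | succ l =>
    rw [eq_top_iff, ← Perm.mclosure_swap_castSucc_succ]
    refine Submonoid.closure_mono ?_
    rintro _ ⟨i, rfl⟩
    exact ⟨i.castSucc, i.succ, by simp, rfl⟩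

/-- Every level set of a surjective map on permutations can be reached by adjacent swaps. -/
theorem exists_adjSwap_descent {X : Type*} {c : Perm (Fin m) → X} (hc : Function.Surjective c) :
    ∃ (d : X → Perm (Fin m) → ℕ) (t : X → Perm (Fin m) → Perm (Fin m)),
      ∀ x p, c p ≠ x → IsAdjSwap (t x p) ∧ d x (t x p * p) < d x p := by
  classical
  have hex : ∀ x p, ∃ N, ∃ L : List (Perm (Fin m)),
      (∀ t ∈ L, IsAdjSwap t) ∧ L.length = N ∧ c (L.prod * p) = x := by
    intro x p
    obtain ⟨q, rfl⟩ := hc x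
    obtain ⟨L, hL, hprod⟩ := Submonoid.exists_list_of_mem_closure
      (show q * p⁻¹ ∈ Submonoid.closure {t : Perm (Fin m) | IsAdjSwap t} by
        rw [mclosure_isAdjSwap]; trivial)
    exact ⟨_, L, hL, rfl, by rw [hprod, inv_mul_cancel_right]⟩
  have key : ∀ x p, ∃ t, c p ≠ x →
      IsAdjSwap t ∧ Nat.find (hex x (t * p)) < Nat.find (hex x p) := by
    intro x p
    obtain ⟨L, hL, hlen, hx⟩ := Nat.find_spec (hex x p)
    -- The distance `d` is the length of a shortest word of swaps into the level set. Its rightmost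
    -- letter acts first, so that letter is `t`; for the empty word `c p = x` and 1 is a dummy.
    rcases List.eq_nil_or_concat L with rfl | ⟨L', t, rfl⟩
    · exact ⟨1, fun h => absurd (by simpa using hx) h⟩
    · refine ⟨t, fun _ => ⟨hL t (by simp), ?_⟩⟩
      rw [← hlen]
      refine lt_of_le_of_lt (Nat.find_min' _ ⟨L', fun u hu => hL u (by simp [hu]), rfl, ?_⟩)
        (by simp)
      simpa [mul_assoc] using hx
  choose t ht using key
  exact ⟨fun x p => Nat.find (hex x p), t, ht⟩

/-- The permutations of `Fin m` can be sorted into `n` classes that do not change under `s`. -/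
theorem exists_invariant_surjection {n : ℕ} (hn : 1 ≤ n) (hnm : 2 * n ≤ m.factorial)
    {s : Perm (Fin m)} (hs : Perm.sign s = -1) (hss : s * s = 1) :
    ∃ c : Perm (Fin m) → Fin n, Function.Surjective c ∧ ∀ p, c (s * p) = c p := by
  classical
  have hm : 2 ≤ m := by
    by_contra h
    have : m.factorial = 1 := Nat.factorial_eq_one.2 (by omega)
    omega
  have : Nontrivial (Fin m) := Fin.nontrivial_iff_two_le.2 hm
  have : Nonempty (Fin n) := ⟨⟨0, hn⟩⟩
  have hcard : n ≤ Fintype.card (alternatingGroup (Fin m)) := by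
    have := two_mul_card_alternatingGroup (α := Fin m)
    rw [Fintype.card_perm, Fintype.card_fin] at this
    omega
  obtain ⟨e⟩ : Nonempty (Fin n ↪ alternatingGroup (Fin m)) :=
    Function.Embedding.nonempty_of_card_le (by simpa using hcard)
  have hodd : ∀ p : Perm (Fin m), ¬ Perm.sign p = 1 → Perm.sign (s * p) = 1 := by
    intro p hp
    rw [Perm.sign_mul, hs, (Int.units_eq_one_or _).resolve_left hp]
    rfl
  -- Each pair `{p, s * p}` has exactly one even member, and `c` reads the value off it.
  refine ⟨fun p => Function.invFun e
    (if h : Perm.sign p = 1 then ⟨p, h⟩ else ⟨s * p, hodd p h⟩), fun x => ⟨e x, ?_⟩, fun p => ?_⟩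
  · have h : Perm.sign (e x : Perm (Fin m)) = 1 := (e x).2
    simp only [h, dif_pos]
    exact Function.leftInverse_invFun e.injective x
  · by_cases h : Perm.sign p = 1
    · have h' : ¬ Perm.sign (s * p) = 1 := by rw [Perm.sign_mul, hs, h]; decide
      simp only [h, h', dif_pos, dif_neg, not_false_eq_true, ← mul_assoc, hss, one_mul]
    · simp only [h, hodd p h, dif_pos, dif_neg, not_false_eq_true]

variable {n : ℕ} (f : Fin n → Fin n) (c : Perm (Fin m) → Fin n) (s : Perm (Fin m))
  (t : Fin n → Perm (Fin m) → Perm (Fin m))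

/-- The value stored in a pair of registers; the signs tell which register holds it. -/
def registerVal (a : Perm (Fin m) × Perm (Fin m)) : Fin n :=
  if Perm.sign a.1 = Perm.sign a.2 then c a.1 else c a.2

/-- The second register has just reached the image under `f` of the value of the first one. -/
def RegisterAdv (a : Perm (Fin m) × Perm (Fin m)) : Prop :=
  Perm.sign a.1 = Perm.sign a.2 ∧ c a.2 = f (c a.1)

/-- The swaps executed on a pair of registers. -/
def registerMove (a : Perm (Fin m) × Perm (Fin m)) : Perm (Fin m) × Perm (Fin m) :=
  if Perm.sign a.1 = Perm.sign a.2 then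
    if c a.2 = f (c a.1) then (s, 1) else (s, t (f (c a.1)) a.2)
  else if c a.1 = c a.2 then (s, 1) else (t (c a.2) a.1, s)

variable {f c s t} {d : Fin n → Perm (Fin m) → ℕ}

theorem isAdjSwap_registerMove (hs : IsAdjSwap s) (ht : ∀ x p, c p ≠ x → IsAdjSwap (t x p))
    (a : Perm (Fin m) × Perm (Fin m)) :
    IsAdjSwap (registerMove f c s t a).1 ∧
      ((registerMove f c s t a).2 = 1 ∨ IsAdjSwap (registerMove f c s t a).2) := by
  unfold registerMove
  split_ifs with h1 h2 h2
  · exact ⟨hs, Or.inl rfl⟩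
  · exact ⟨hs, Or.inr (ht _ _ h2)⟩
  · exact ⟨hs, Or.inl rfl⟩
  · exact ⟨ht _ _ h2, Or.inr hs⟩

/-- Two swaps preserve agreement of the signs and `s` protects the holder's value. A lone `s`
changes the holder, to a register that already contains `f` of the value or a copy of it. -/
theorem registerVal_step (hs : IsAdjSwap s) (hcs : ∀ p, c (s * p) = c p)
    (ht : ∀ x p, c p ≠ x → IsAdjSwap (t x p)) (a : Perm (Fin m) × Perm (Fin m))
    [Decidable (RegisterAdv f c a)] :
    registerVal c (registerMove f c s t a * a) =
      if RegisterAdv f c a then f (registerVal c a) else registerVal c a := by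
  have hneg : ∀ u : ℤˣ, u ≠ -u := by decide
  have hneg' : ∀ u v : ℤˣ, u ≠ v → -u = v := by decide
  unfold registerMove RegisterAdv
  by_cases h1 : Perm.sign a.1 = Perm.sign a.2
  · by_cases h2 : c a.2 = f (c a.1)
    · simp [registerVal, h1, h2, hs.sign, (hneg _).symm]
    · simp [registerVal, h1, h2, hs.sign, (ht _ _ h2).sign, hcs]
  · by_cases h2 : c a.1 = c a.2
    · simp [registerVal, h1, h2, hs.sign, hcs, hneg' _ _ h1]
    · simp [registerVal, h1, h2, hs.sign, (ht _ _ h2).sign, hcs]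

/-- The idle swap keeps the target fixed, so the distance of the driven register to it strictly
decreases. The copying phase ends in the phase that computes `f`. -/
theorem exists_registerAdv (hs : IsAdjSwap s) (hcs : ∀ p, c (s * p) = c p)
    (ht : ∀ x p, c p ≠ x → IsAdjSwap (t x p) ∧ d x (t x p * p) < d x p)
    (a : Perm (Fin m) × Perm (Fin m)) :
    ∃ i, RegisterAdv f c ((fun a => registerMove f c s t a * a)^[i] a) := by
  have hneg' : ∀ u v : ℤˣ, u ≠ v → -u = v := by decide
  have heq : ∀ N a, d (f (c a.1)) a.2 = N → Perm.sign a.1 = Perm.sign a.2 →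
      ∃ i, RegisterAdv f c ((fun a => registerMove f c s t a * a)^[i] a) := by
    intro N
    induction N using Nat.strong_induction_on with
    | _ N ih =>
      intro a hN h1
      by_cases h2 : c a.2 = f (c a.1)
      · exact ⟨0, h1, h2⟩
      · have hm : registerMove f c s t a = (s, t (f (c a.1)) a.2) := by
          simp [registerMove, h1, h2]
        obtain ⟨i, hi⟩ := ih _ (hN ▸ (ht _ _ h2).2) (registerMove f c s t a * a)
          (by simp [hm, hcs]) (by simp [hm, h1, hs.sign, (ht _ _ h2).1.sign])
        exact ⟨i + 1, hi⟩
  have hne : ∀ N a, d (c a.2) a.1 = N → Perm.sign a.1 ≠ Perm.sign a.2 →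
      ∃ i, RegisterAdv f c ((fun a => registerMove f c s t a * a)^[i] a) := by
    intro N
    induction N using Nat.strong_induction_on with
    | _ N ih =>
      intro a hN h1
      by_cases h2 : c a.1 = c a.2
      · have hm : registerMove f c s t a = (s, 1) := by simp [registerMove, h1, h2]
        obtain ⟨i, hi⟩ := heq _ (registerMove f c s t a * a) rfl
          (by simp [hm, hs.sign, hneg' _ _ h1])
        exact ⟨i + 1, hi⟩
      · have hm : registerMove f c s t a = (t (c a.2) a.1, s) := by simp [registerMove, h1, h2]
        obtain ⟨i, hi⟩ := ih _ (hN ▸ (ht _ _ h2).2) (registerMove f c s t a * a)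
          (by simp [hm, hcs]) (by simp [hm, h1, hs.sign, (ht _ _ h2).1.sign])
        exact ⟨i + 1, hi⟩
  by_cases h : Perm.sign a.1 = Perm.sign a.2
  · exact heq _ a rfl h
  · exact hne _ a rfl h

end Registers

/-! ### Registers on the two halves of the path -/

/-- The vertices of the path with `2 * m` vertices, split into two halves. -/
def halves (m : ℕ) : Fin m ⊕ Fin m ≃ Fin (2 * m) :=
  finSumFinEquiv.trans (finCongr (by omega))

theorem halves_inl_val {m : ℕ} (i : Fin m) : (halves m (Sum.inl i)).val = i.val := rfl

theorem halves_inr_val {m : ℕ} (i : Fin m) : (halves m (Sum.inr i)).val = m + i.val := rfl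

/-- A pair of permutations of the halves, acting on the path. -/
def halvesPerm {m : ℕ} (a : Perm (Fin m) × Perm (Fin m)) (v : Fin (2 * m)) : Fin (2 * m) :=
  halves m (Sum.map a.1 a.2 ((halves m).symm v))

theorem halvesPerm_mul {m : ℕ} (a b : Perm (Fin m) × Perm (Fin m)) (v : Fin (2 * m)) :
    halvesPerm (a * b) v = halvesPerm a (halvesPerm b v) := by
  simp only [halvesPerm, symm_apply_apply, Sum.map_map]
  rfl

theorem halvesPerm_local {m : ℕ} {a : Perm (Fin m) × Perm (Fin m)}
    (h1 : IsAdjSwap a.1) (h2 : a.2 = 1 ∨ IsAdjSwap a.2) (v : Fin (2 * m)) :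
    v = halvesPerm a v ∨ (orientedPath (2 * m)).Adj v (halvesPerm a v) := by
  obtain ⟨w, rfl⟩ := (halves m).surjective v
  have hadj : ∀ u v, (orientedPath (2 * m)).Adj u v ↔ u.val + 1 = v.val ∨ v.val + 1 = u.val :=
    fun _ _ => SimpleGraph.pathGraph_adj
  rw [hadj]
  simp only [halvesPerm, symm_apply_apply]
  cases w with
  | inl i =>
    simp only [Sum.map_inl, halves_inl_val, (halves m).injective.eq_iff, Sum.inl.injEq]
    exact h1.apply i
  | inr i =>
    simp only [Sum.map_inr, halves_inr_val, (halves m).injective.eq_iff, Sum.inr.injEq]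
    rcases h2 with h2 | h2
    · simp [h2]
    · have := h2.apply i
      omega

/-- An arrangement with `i` robots at the `i`-th vertex of each half of the path. -/
theorem exists_staircase (m : ℕ) : ∃ a : Arrangement (Fin (2 * m)) (m * (m - 1)),
    ∀ w, Nat.card {r // a r = halves m w} = (w.elim id id : Fin m).val := by
  -- The robots number 2(0 + 1 + ⋯ + (m - 1)) = m(m - 1).
  let T := Σ w : Fin m ⊕ Fin m, Fin (w.elim id id : Fin m).val
  have hT : Fintype.card T = m * (m - 1) := by
    rw [Fintype.card_sigma]
    simp only [Fintype.card_fin, Fintype.sum_sum_type, Sum.elim_inl, Sum.elim_inr, id_eq]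
    rw [Fin.sum_univ_eq_sum_range (fun i => i), ← Finset.sum_range_id_mul_two]
    omega
  let e : Fin (m * (m - 1)) ≃ T := (Fintype.equivFinOfCardEq hT).symm
  refine ⟨fun r => halves m (e r).1, fun w => ?_⟩
  have e1 : {r // halves m (e r).1 = halves m w} ≃ {x : T // x.1 = w} :=
    e.subtypeEquiv fun r => (halves m).injective.eq_iff
  rw [Nat.card_congr (e1.trans (Equiv.sigmaSubtype w)), Nat.card_eq_fintype_card, Fintype.card_fin]

/-- By rigidity a configuration determines the pile sizes at all vertices; sizes within a half are
distinct, so they reveal both permutations. -/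
theorem halvesPerm_config_injective {m k : ℕ} {a : Arrangement (Fin (2 * m)) k}
    (ha : ∀ w, Nat.card {r // a r = halves m w} = (w.elim id id : Fin m).val) :
    Function.Injective fun p : Perm (Fin m) × Perm (Fin m) =>
      Config.mk (orientedPath (2 * m)) fun r => halvesPerm p (a r) := by
  intro p q hpq
  obtain ⟨π, hπ⟩ := (orientedPath_rigid (2 * m)).mk_eq_mk hpq
  have hcard : ∀ (p : Perm (Fin m) × Perm (Fin m)) w,
      Nat.card {r // halvesPerm p (a r) = halves m w} =
        ((Sum.map p.1.symm p.2.symm w).elim id id : Fin m).val := by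
    intro p w
    rw [← ha]
    refine Nat.card_congr (Equiv.subtypeEquivRight fun r => ?_)
    obtain ⟨u, hu⟩ := (halves m).surjective (a r)
    simp only [← hu, halvesPerm, symm_apply_apply, (halves m).injective.eq_iff]
    cases u <;> cases w <;> simp [Equiv.eq_symm_apply]
  have hpq' : ∀ w, ((Sum.map p.1.symm p.2.symm w).elim id id : Fin m).val =
      ((Sum.map q.1.symm q.2.symm w).elim id id : Fin m).val := by
    intro w
    rw [← hcard, ← hcard]
    exact Nat.card_congr (π.subtypeEquiv fun r => by rw [hπ r])
  have h1 : p.1.symm = q.1.symm := Equiv.ext fun i => Fin.ext (hpq' (Sum.inl i))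
  have h2 : p.2.symm = q.2.symm := Equiv.ext fun i => Fin.ext (hpq' (Sum.inr i))
  exact Prod.ext (Equiv.symm_bijective.injective h1) (Equiv.symm_bijective.injective h2)

theorem orientedPath_universal {m n : ℕ} (hn : 1 ≤ n) (hnm : 2 * n ≤ m.factorial) :
    UniversalFor (OP (2 * m) (m * (m - 1))) n := by
  classical
  intro f
  have hm : 2 ≤ m := by
    by_contra h
    have : m.factorial = 1 := Nat.factorial_eq_one.2 (by omega)
    omega
  let s : Perm (Fin m) := swap ⟨0, by omega⟩ ⟨1, by omega⟩
  have hs : IsAdjSwap s := ⟨_, _, rfl, rfl⟩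
  obtain ⟨c, hc, hcs⟩ := exists_invariant_surjection hn hnm hs.sign (swap_mul_self _ _)
  obtain ⟨d, t, ht⟩ := exists_adjSwap_descent hc
  obtain ⟨a, ha⟩ := exists_staircase m
  refine (orientedPath_rigid (2 * m)).computes ⟨0, hn⟩ (fun p r => halvesPerm p (a r))
    (halvesPerm_config_injective ha) (fun p => halvesPerm (registerMove f c s t p))
    (fun p => ?_) (fun p => registerMove f c s t p * p) (fun p r => halvesPerm_mul _ _ _)
    (registerVal c) (fun x => ?_) (RegisterAdv f c)
    (fun p => registerVal_step hs hcs (fun x p h => (ht x p h).1) p) (exists_registerAdv hs hcs ht)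
  · have := isAdjSwap_registerMove (f := f) hs (fun x p h => (ht x p h).1) p
    exact halvesPerm_local this.1 this.2
  · obtain ⟨p, rfl⟩ := hc x
    exact ⟨(p, p), by simp [registerVal]⟩

end MobileRobots

/-! ### The choice of `m` and the theorem -/

theorem existsUnique_factorial_lt_le {N : ℕ} (hN : 2 ≤ N) :
    ∃! m : ℕ, Nat.factorial (m - 1) < N ∧ N ≤ Nat.factorial m := by
  have hex : ∃ m, N ≤ Nat.factorial m := ⟨N, Nat.self_le_factorial N⟩
  refine ⟨Nat.find hex, ⟨?_, Nat.find_spec hex⟩, ?_⟩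
  · have h0 : Nat.find hex ≠ 0 := fun h => by
      have := Nat.find_spec hex
      rw [h, Nat.factorial_zero] at this
      omega
    exact not_le.1 (Nat.find_min hex (by omega))
  · rintro m ⟨h1, h2⟩
    refine le_antisymm ?_ (Nat.find_min' hex h2)
    by_contra h
    have := (Nat.find_spec hex).trans (Nat.factorial_le (show Nat.find hex ≤ m - 1 by omega))
    omega

theorem mainTheorem6 :
    (∀ n : ℕ, 1 ≤ n →
      (∃! m : ℕ, Nat.factorial (m - 1) < 2 * n ∧ 2 * n ≤ Nat.factorial m) ∧
      ∀ m : ℕ, Nat.factorial (m - 1) < 2 * n → 2 * n ≤ Nat.factorial m →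
        MobileRobots.UniversalFor (MobileRobots.OP (2 * m) (m * (m - 1))) n) ∧
    (∀ m n : ℕ, 2 ≤ m → 2 * n = Nat.factorial m →
      MobileRobots.UniversalFor (MobileRobots.OP (2 * m) (m * (m - 1))) n) := by
  refine ⟨fun n hn => ⟨existsUnique_factorial_lt_le (by omega), fun m _ h =>
    MobileRobots.orientedPath_universal hn h⟩, fun m n _ h =>
    MobileRobots.orientedPath_universal ?_ h.le⟩
  have := Nat.factorial_pos m
  omega
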